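/- Let $n\ge 0$ and $K\ge1$, let $0<\tau_1<\dots<\tau_K<\infty$, and let $H_{-K},\dots,H_K\in\mathbb R^{2n\times 2n}$ satisfy $(JH_0)^\top=JH_0$ and $(JH_{-k})^\top=JH_k$ for $k=1,\dots,K$, where $J=\begin{bmatrix}0&I_n\\-I_n&0\end{bmatrix}$. Put $$M(z)=zI_{2n}-H_0-\sum_{k=1}^K\left(H_{-k}e^{-z\tau_k}+H_ke^{z\tau_k}\right),\qquad z\in\mathbb C.$$ Let $X=C([-\tau_K,\tau_K],\mathbb C^{2n})$ and let $\mathcal H:D(\mathcal H)\subseteq X\to X$ be the operator $\mathcal H\varphi=\varphi'$, where $D(\mathcal H)$ is the set of continuously differentiable $\varphi\in X$ with $\varphi'(0)=H_0\varphi(0)+\sum_{k=1}^K\left(H_{-k}\varphi(-\tau_k)+H_k\varphi(\tau_k)\right)$. For $\sigma\in\mathbb C$ let $\mathcal R_\sigma=(\mathcal H-\sigma I)(\mathcal H+\sigma I)$ with its natural domain $D(\mathcal R_\sigma)=\{\varphi\in D(\mathcal H):\varphi'\in D(\mathcal H)\}$. For $\varphi,\psi\in X$ let $$\langle\varphi,\psi\rangle=\psi(0)^\top\varphi(0)+\sum_{k=1}^K\left(\int_0^{\tau_k}\psi(\theta)^\top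 H_{-k}\varphi(\theta-\tau_k)\,d\theta-\int_0^{\tau_k}\psi(\theta-\tau_k)^\top H_k\varphi(\theta)\,d\theta\right).$$ **Theorem.** Let $\sigma\in\mathbb C$ not be an eigenvalue of $\mathcal H$ and let $\phi_1\in X$ be real-valued. Let $\lambda\ne0$ be a simple eigenvalue of $\mathcal H$ (that is, its algebraic multiplicity, the dimension of $\bigcup_j\ker(\mathcal H-\lambda I)^j$, is $1$) with eigenfunction $\varphi_+$, and let $\varphi_-$ be an eigenfunction of $\mathcal H$ for the eigenvalue $-\lambda$. Then $\mathcal R_\sigma:D(\mathcal R_\sigma)\to X$ is bijective, and for every integer $m\ge0$ $$\dim\left(\operatorname{span}\{\varphi_+,\varphi_-\}\cap \mathrm K_m(\mathcal R_\sigma^{-1},\phi_1)\right)\le 1,\qquad \mathrm K_m(\mathcal R_\sigma^{-1},\phi_1)=\operatorname{span}\{\phi_1,\mathcal R_\sigma^{-1}\phi_1,\dots,\mathcal R_\sigma^{-(m-1)}\phi_1\}.$$ Moreover, there are nonzero vectors $v_+,w_+\in\mathbb C^{2n}$ with $M(\lambda)v_+=0$, $w_+^\top M(\lambda)=0$, $\varphi_+(\theta)=e^{\lambda\theta}v_+$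 and $\varphi_-(\theta)=e^{-\lambda\theta}Jw_+$ for all $\theta\in[-\tau_K,\tau_K]$, and $$\langle\varphi_+,J\varphi_-\rangle=-w_+^\top M'(\lambda)v_+\neq0.$$ -/

import Mathlib

open scoped Matrix

noncomputable section

/-! ### Eigenvalues of a partially defined linear operator -/

namespace LinearPMap

variable {E : Type*} [AddCommGroup E] [Module ℂ E]

/-- `x` is an eigenvector of the partially defined operator `A` for the eigenvalue `μ`. -/
def IsEigenpair (A : E →ₗ.[ℂ] E) (μ : ℂ) (x : E) : Prop :=
  x ≠ 0 ∧ ∃ hx : x ∈ A.domain, A ⟨x, hx⟩ = μ • x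

/-- `μ` is an eigenvalue of `A`. -/
def IsEigenvalue (A : E →ₗ.[ℂ] E) (μ : ℂ) : Prop :=
  ∃ x, A.IsEigenpair μ x

/-- The kernel of `(A - μ)^j`, with the natural domain of the power: `x` lies in the kernel of
`(A - μ)^(j+1)` when `x` is in the domain of `A` and `A x - μ x` is in the kernel
of `(A - μ)^j`. -/
def genKer (A : E →ₗ.[ℂ] E) (μ : ℂ) : ℕ → Submodule ℂ E
  | 0 => ⊥
  | j + 1 => ((genKer A μ j).comap (A.toFun - μ • A.domain.subtype)).map A.domain.subtype

/-- The generalized eigenspace of `A` at `μ`: the union of the kernels of `(A - μ)^j`. -/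
def genEigenspace (A : E →ₗ.[ℂ] E) (μ : ℂ) : Submodule ℂ E :=
  ⨆ j, A.genKer μ j

/-- `μ` is a simple eigenvalue of `A`: its algebraic multiplicity, the dimension of the
generalized eigenspace, is one. -/
def IsSimpleEigenvalue (A : E →ₗ.[ℂ] E) (μ : ℂ) : Prop :=
  Module.finrank ℂ (A.genEigenspace μ) = 1

end LinearPMap

/-- The Krylov subspace spanned by `x, A x, …, A ^ (m - 1) x`. -/
def krylovSubspace {E : Type*} [AddCommGroup E] [Module ℂ E] (A : E →ₗ[ℂ] E) (x : E) (m : ℕ) :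
    Submodule ℂ E :=
  Submodule.span ℂ {y | ∃ j : ℕ, j < m ∧ y = (A ^ j) x}

/-- The matrix `J` with blocks `0, I, -I, 0`. -/
def hamJ (n : ℕ) (R : Type*) [Ring R] : Matrix (Fin n ⊕ Fin n) (Fin n ⊕ Fin n) R :=
  Matrix.fromBlocks 0 1 (-1) 0

/-- Delays `0 < τ 1 < ⋯ < τ K` (with `K ≥ 1`) and real `2n × 2n` matrices `H k`, `-K ≤ k ≤ K`,
with the Hamiltonian structure. Values of `τ` and `H` at other indices play no role. -/
structure HamDelaySystem (n K : ℕ) where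
  one_le_K : 1 ≤ K
  τ : ℕ → ℝ
  τ_pos : ∀ k ∈ Set.Icc 1 K, 0 < τ k
  τ_strictMono : StrictMonoOn τ (Set.Icc 1 K)
  H : ℤ → Matrix (Fin n ⊕ Fin n) (Fin n ⊕ Fin n) ℝ
  ham_zero : (hamJ n ℝ * H 0)ᵀ = hamJ n ℝ * H 0
  ham : ∀ k ∈ Set.Icc 1 K, (hamJ n ℝ * H (-(k : ℤ)))ᵀ = hamJ n ℝ * H (k : ℤ)

namespace HamDelaySystem

variable {n K : ℕ} (S : HamDelaySystem n K)

/-- `H k`, regarded as a complex matrix. -/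
def Hc (k : ℤ) : Matrix (Fin n ⊕ Fin n) (Fin n ⊕ Fin n) ℂ :=
  (S.H k).map Complex.ofReal

/-- The characteristic matrix `M(z) = z I - H₀ - ∑ k, (H₋ₖ exp (-z τₖ) + Hₖ exp (z τₖ))`. -/
def charMatrix (z : ℂ) : Matrix (Fin n ⊕ Fin n) (Fin n ⊕ Fin n) ℂ :=
  z • (1 : Matrix (Fin n ⊕ Fin n) (Fin n ⊕ Fin n) ℂ) - S.Hc 0 -
    ∑ k ∈ Finset.Icc 1 K,
      (Complex.exp (-z * (S.τ k : ℂ)) • S.Hc (-(k : ℤ)) +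
        Complex.exp (z * (S.τ k : ℂ)) • S.Hc (k : ℤ))

/-- The (entrywise) derivative `M'(z)` of the characteristic matrix. -/
def charMatrixDeriv (z : ℂ) : Matrix (Fin n ⊕ Fin n) (Fin n ⊕ Fin n) ℂ :=
  Matrix.of fun i j => deriv (fun s => S.charMatrix s i j) z

/-- The interval `[-τ_K, τ_K]`. -/
abbrev dom : Set ℝ := Set.Icc (-(S.τ K)) (S.τ K)

theorem τ_last_pos : 0 < S.τ K :=
  S.τ_pos K ⟨S.one_le_K, le_rfl⟩

theorem neg_lt : -(S.τ K) < S.τ K := by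
  have := S.τ_last_pos
  linarith

/-- The space `X` of continuous functions from `[-τ_K, τ_K]` to `ℂ²ⁿ`. -/
abbrev X : Type := C(S.dom, Fin n ⊕ Fin n → ℂ)

/-- The value of `φ` at the real number `t`, for `t` in `[-τ_K, τ_K]` (outside of the
interval the function is continued by its boundary values, which are never used). -/
def ev (φ : S.X) (t : ℝ) : Fin n ⊕ Fin n → ℂ :=
  φ (Set.projIcc (-(S.τ K)) (S.τ K) S.neg_lt.le t)

/-- `φ` is differentiable on `[-τ_K, τ_K]` (one-sided at the end points) with derivative `ψ`. -/
def IsDeriv (φ ψ : S.X) : Prop :=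
  ∀ t ∈ S.dom, HasDerivWithinAt (S.ev φ) (S.ev ψ t) S.dom t

/-- `H₀ φ(0) + ∑ k, (H₋ₖ φ(-τₖ) + Hₖ φ(τₖ))`. -/
def boundaryMap (φ : S.X) : Fin n ⊕ Fin n → ℂ :=
  S.Hc 0 *ᵥ S.ev φ 0 +
    ∑ k ∈ Finset.Icc 1 K,
      (S.Hc (-(k : ℤ)) *ᵥ S.ev φ (-(S.τ k)) + S.Hc (k : ℤ) *ᵥ S.ev φ (S.τ k))

theorem IsDeriv.unique {S : HamDelaySystem n K} {φ ψ₁ ψ₂ : S.X} (h₁ : S.IsDeriv φ ψ₁)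
    (h₂ : S.IsDeriv φ ψ₂) : ψ₁ = ψ₂ := by
  ext1 t
  have hu := uniqueDiffOn_Icc S.neg_lt t.1 t.2
  have h := hu.eq_deriv _ (h₁ t.1 t.2) (h₂ t.1 t.2)
  simpa [ev] using h

theorem IsDeriv.add {S : HamDelaySystem n K} {φ₁ φ₂ ψ₁ ψ₂ : S.X} (h₁ : S.IsDeriv φ₁ ψ₁)
    (h₂ : S.IsDeriv φ₂ ψ₂) : S.IsDeriv (φ₁ + φ₂) (ψ₁ + ψ₂) :=
  fun t ht => (h₁ t ht).add (h₂ t ht)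

theorem IsDeriv.smul {S : HamDelaySystem n K} {φ ψ : S.X} (c : ℂ) (h : S.IsDeriv φ ψ) :
    S.IsDeriv (c • φ) (c • ψ) :=
  fun t ht => (h t ht).const_smul c

theorem boundaryMap_add (φ ψ : S.X) :
    S.boundaryMap (φ + ψ) = S.boundaryMap φ + S.boundaryMap ψ := by
  have h : ∀ t, S.ev (φ + ψ) t = S.ev φ t + S.ev ψ t := fun _ => rfl
  simp only [boundaryMap, h, Matrix.mulVec_add, Finset.sum_add_distrib]
  abel

theorem boundaryMap_smul (c : ℂ) (φ : S.X) :
    S.boundaryMap (c • φ) = c • S.boundaryMap φ := by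
  have h : ∀ t, S.ev (c • φ) t = c • S.ev φ t := fun _ => rfl
  simp only [boundaryMap, h, Matrix.mulVec_smul, smul_add, Finset.smul_sum]

/-- The domain of `𝓗`: functions `φ` in `X` whose derivative is in `X` and which satisfy
`φ'(0) = H₀ φ(0) + ∑ k, (H₋ₖ φ(-τₖ) + Hₖ φ(τₖ))`. -/
def opDomain : Submodule ℂ S.X where
  carrier := {φ | ∃ ψ : S.X, S.IsDeriv φ ψ ∧ S.ev ψ 0 = S.boundaryMap φ}
  add_mem' := by
    rintro φ₁ φ₂ ⟨ψ₁, h₁, e₁⟩ ⟨ψ₂, h₂, e₂⟩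
    refine ⟨ψ₁ + ψ₂, h₁.add h₂, ?_⟩
    rw [boundaryMap_add, ← e₁, ← e₂]
    rfl
  zero_mem' := by
    refine ⟨0, fun t _ => hasDerivWithinAt_const _ _ _, ?_⟩
    have h := S.boundaryMap_smul 0 0
    rw [zero_smul ℂ (0 : S.X), zero_smul] at h
    rw [h]
    rfl
  smul_mem' := by
    rintro c φ ⟨ψ, h, e⟩
    refine ⟨c • ψ, h.smul c, ?_⟩
    rw [boundaryMap_smul, ← e]
    rfl

/-- The operator `𝓗 φ = φ'` on its domain. -/
def op : S.X →ₗ.[ℂ] S.X where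
  domain := S.opDomain
  toFun :=
    { toFun := fun φ => φ.2.choose
      map_add' := fun φ₁ φ₂ =>
        (φ₁ + φ₂).2.choose_spec.1.unique (φ₁.2.choose_spec.1.add φ₂.2.choose_spec.1)
      map_smul' := fun c φ =>
        (c • φ).2.choose_spec.1.unique (φ.2.choose_spec.1.smul c) }

/-- The operator `𝓗 + c` with domain `D(𝓗)`. -/
def opShift (c : ℂ) : S.X →ₗ.[ℂ] S.X where
  domain := S.op.domain
  toFun := S.op.toFun + c • S.op.domain.subtype

/-- The operator `R_σ = (𝓗 - σ)(𝓗 + σ)` with its natural domain: the functions `φ` in `D(𝓗)`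
for which `(𝓗 + σ) φ` is in `D(𝓗)`. -/
def shiftOp (σ : ℂ) : S.X →ₗ.[ℂ] S.X :=
  (S.opShift (-σ)).comp
    ((S.opShift σ).domRestrict
      (((S.opShift (-σ)).domain.comap (S.opShift σ).toFun).map (S.opShift σ).domain.subtype))
    (by
      rintro ⟨x, hx, hx'⟩
      obtain ⟨y, hy, rfl⟩ := hx
      exact hy)

open Classical in
/-- The inverse `R_σ⁻¹ : X → X` of `R_σ : D(R_σ) → X` (by convention zero when `R_σ` is not
a bijection of `D(R_σ)` onto `X`). -/
def shiftInv (σ : ℂ) : S.X →ₗ[ℂ] S.X :=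
  if h : Function.Bijective (S.shiftOp σ).toFun then
    (S.shiftOp σ).domain.subtype ∘ₗ (LinearEquiv.ofBijective (S.shiftOp σ).toFun h).symm.toLinearMap
  else 0

/-- The function `J φ`. -/
def applyJ (φ : S.X) : S.X :=
  ⟨fun t => hamJ n ℂ *ᵥ φ t, by fun_prop⟩

/-- The bilinear form
`⟨φ, ψ⟩ = ψ(0)ᵀ φ(0) + ∑ k, (∫₀^τₖ ψ(θ)ᵀ H₋ₖ φ(θ - τₖ) dθ - ∫₀^τₖ ψ(θ - τₖ)ᵀ Hₖ φ(θ) dθ)`. -/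
def bilin (φ ψ : S.X) : ℂ :=
  S.ev ψ 0 ⬝ᵥ S.ev φ 0 +
    ∑ k ∈ Finset.Icc 1 K,
      ((∫ θ in (0 : ℝ)..S.τ k, S.ev ψ θ ⬝ᵥ (S.Hc (-(k : ℤ)) *ᵥ S.ev φ (θ - S.τ k))) -
        ∫ θ in (0 : ℝ)..S.τ k, S.ev ψ (θ - S.τ k) ⬝ᵥ (S.Hc (k : ℤ) *ᵥ S.ev φ θ))

end HamDelaySystem

end

noncomputable section

/-! The form $(\varphi,\psi)\mapsto\langle\varphi,J\psi\rangle$ (`skewForm`) is bilinear and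
skew-symmetric, and $\mathcal H$ is skew for it (`skewForm_op`): integration by parts leaves
boundary terms, which the condition at $0$ and the Hamiltonian structure cancel. Passing two factors
across the form restores the sign, so $\mathcal R_\sigma^{-1}$ is symmetric (`skewForm_shiftInv`),
and Krylov spaces of a symmetric operator are isotropic (`krylovSubspace_isotropic`).

The eigenfunctions pair to $-w^\top M'(\lambda)v$ (`bilin_expFun`). If this vanished,
$M(\lambda)u=-M'(\lambda)v$ would be solvable and would yield a Jordan chain of length two, against
simplicity (`dotProduct_charMatrixDeriv_ne_zero`). Hence the Krylov space cannot contain both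
eigenfunctions, and it meets their span in dimension at most one.

Bijectivity of $\mathcal R_\sigma$ (`shiftOp_bijective`) rests on variation of constants and on the
symmetry of the spectrum under $z\mapsto-z$. -/

/-- A Krylov subspace of an operator which is symmetric for a skew-symmetric bilinear form is
isotropic. -/
theorem krylovSubspace_isotropic {E : Type*} [AddCommGroup E] [Module ℂ E]
    (B : E →ₗ[ℂ] E →ₗ[ℂ] ℂ) (hB : ∀ x y, B x y = -B y x) (A : E →ₗ[ℂ] E)
    (hA : ∀ x y, B (A x) y = B x (A y)) (x : E) (m : ℕ) {u v : E}
    (hu : u ∈ krylovSubspace A x m) (hv : v ∈ krylovSubspace A x m) : B u v = 0 := by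
  have hpow : ∀ (i : ℕ) (y z : E), B ((A ^ i) y) z = B y ((A ^ i) z) := by
    intro i
    induction i with
    | zero => intro y z; rfl
    | succ i ih => intro y z; rw [pow_succ, Module.End.mul_apply, ih, hA, ← Module.End.mul_apply,
        ← pow_succ', ← pow_succ]
  -- Moving all powers to one side gives the same value for $(i,j)$ and $(j,i)$; by skew-symmetry
  -- that value is its own negative.
  have hgen : ∀ i j : ℕ, B ((A ^ i) x) ((A ^ j) x) = 0 := by
    intro i j
    have h₁ : B ((A ^ i) x) ((A ^ j) x) = B x ((A ^ (i + j)) x) := by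
      rw [hpow, ← Module.End.mul_apply, ← pow_add]
    have h₂ : B ((A ^ j) x) ((A ^ i) x) = B x ((A ^ (i + j)) x) := by
      rw [hpow, ← Module.End.mul_apply, ← pow_add, add_comm]
    have h₃ := hB ((A ^ i) x) ((A ^ j) x)
    rw [h₂, h₁] at h₃
    rw [h₁]
    exact self_eq_neg.mp h₃
  unfold krylovSubspace at hu hv
  induction hu using Submodule.span_induction with
  | mem u hu =>
    obtain ⟨i, -, rfl⟩ := hu
    induction hv using Submodule.span_induction with
    | mem v hv => obtain ⟨j, -, rfl⟩ := hv; exact hgen i j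
    | zero => simp
    | add _ _ _ _ h₁ h₂ => rw [map_add, h₁, h₂, add_zero]
    | smul c _ _ h => rw [map_smul, h, smul_zero]
  | zero => simp
  | add _ _ _ _ h₁ h₂ => rw [map_add, LinearMap.add_apply, h₁, h₂, add_zero]
  | smul c _ _ h => rw [map_smul, LinearMap.smul_apply, h, smul_zero]

theorem finrank_span_pair_inf_le_one {E : Type*} [AddCommGroup E] [Module ℂ E] (x y : E)
    (V : Submodule ℂ E) (h : x ∈ V → y ∈ V → False) :
    Module.finrank ℂ ↥(Submodule.span ℂ {x, y} ⊓ V) ≤ 1 := by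
  by_contra! hlt
  have hfin : FiniteDimensional ℂ ↥(Submodule.span ℂ ({x, y} : Set E)) :=
    FiniteDimensional.span_of_finite ℂ (Set.toFinite _)
  have h₂ : Module.finrank ℂ ↥(Submodule.span ℂ ({x, y} : Set E)) ≤ 2 := by
    classical
    have := finrank_span_finset_le_card (R := ℂ) ({x, y} : Finset E)
    rw [Finset.coe_pair] at this
    exact this.trans Finset.card_le_two
  -- An intersection of dimension at least two fills the span, whose dimension is at most two.
  have heq := Submodule.eq_of_le_of_finrank_le
    (inf_le_left : Submodule.span ℂ {x, y} ⊓ V ≤ Submodule.span ℂ {x, y}) (by omega)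
  have hle : Submodule.span ℂ {x, y} ≤ V := inf_eq_left.mp heq
  exact h (hle (Submodule.subset_span (by simp))) (hle (Submodule.subset_span (by simp)))

theorem LinearPMap.mem_genKer_succ {E : Type*} [AddCommGroup E] [Module ℂ E]
    (A : E →ₗ.[ℂ] E) (μ : ℂ) (j : ℕ) (x : A.domain) (h : A x - μ • (x : E) ∈ A.genKer μ j) :
    (x : E) ∈ A.genKer μ (j + 1) :=
  ⟨x, h, rfl⟩

/-- All stages of the generalized kernel lie in one line. This is used both to see that $\ker
M(\lambda)$ is a line and to exclude a Jordan chain. -/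
theorem LinearPMap.exists_smul_eq_of_isSimpleEigenvalue {E : Type*} [AddCommGroup E] [Module ℂ E]
    {A : E →ₗ.[ℂ] E} {μ : ℂ} (hs : A.IsSimpleEigenvalue μ) {x y : E} {i j : ℕ} (hx0 : x ≠ 0)
    (hx : x ∈ A.genKer μ i) (hy : y ∈ A.genKer μ j) : ∃ c : ℂ, c • x = y := by
  have hx' : x ∈ A.genEigenspace μ := le_iSup (fun j => A.genKer μ j) i hx
  have hy' : y ∈ A.genEigenspace μ := le_iSup (fun j => A.genKer μ j) j hy
  obtain ⟨c, hc⟩ := exists_smul_eq_of_finrank_eq_one hs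
    (x := ⟨x, hx'⟩) (fun h => hx0 (congrArg Subtype.val h)) ⟨y, hy'⟩
  exact ⟨c, congrArg Subtype.val hc⟩

/-! ### Matrix identities for $J$, kernel and range, a product rule -/

theorem hamJ_mul_hamJ (n : ℕ) (R : Type*) [Ring R] : hamJ n R * hamJ n R = -1 := by
  simp [hamJ, Matrix.fromBlocks_multiply, ← Matrix.fromBlocks_one, Matrix.fromBlocks_neg]

theorem hamJ_transpose (n : ℕ) (R : Type*) [Ring R] : (hamJ n R)ᵀ = -hamJ n R := by
  simp [hamJ, Matrix.fromBlocks_transpose, Matrix.fromBlocks_neg]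

theorem hamJ_map (n : ℕ) : (hamJ n ℝ).map Complex.ofReal = hamJ n ℂ := by
  ext i j
  rcases i with i | i <;> rcases j with j | j <;> simp [hamJ, Matrix.one_apply] <;>
    split_ifs <;> simp

theorem hamJ_mulVec_hamJ_mulVec {n : ℕ} {R : Type*} [Ring R] (x : Fin n ⊕ Fin n → R) :
    hamJ n R *ᵥ (hamJ n R *ᵥ x) = -x := by
  rw [Matrix.mulVec_mulVec, hamJ_mul_hamJ, Matrix.neg_mulVec, Matrix.one_mulVec]

theorem hamJ_mulVec_dotProduct {n : ℕ} {R : Type*} [CommRing R] (x y : Fin n ⊕ Fin n → R) :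
    (hamJ n R *ᵥ x) ⬝ᵥ y = -(x ⬝ᵥ (hamJ n R *ᵥ y)) := by
  rw [Matrix.dotProduct_mulVec, ← Matrix.mulVec_transpose, hamJ_transpose, Matrix.neg_mulVec,
    neg_dotProduct, neg_neg]

/-- A square matrix whose kernel is spanned by one vector has a range cut out by one nonzero
vector of its left kernel. -/
theorem Matrix.exists_mulVec_eq_of_dotProduct_eq_zero {ι : Type*} [Fintype ι] [DecidableEq ι]
    {A : Matrix ι ι ℂ} {v w y : ι → ℂ} (hker : ∀ u, A *ᵥ u = 0 → ∃ c : ℂ, c • v = u)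
    (hw0 : w ≠ 0) (hw : w ᵥ* A = 0) (hy : w ⬝ᵥ y = 0) : ∃ u, A *ᵥ u = y := by
  let f : (ι → ℂ) →ₗ[ℂ] ℂ := dotProductBilin ℂ ℂ w
  have hf : f ≠ 0 := fun h => hw0 <| by
    ext i
    have := LinearMap.congr_fun h (Pi.single i 1)
    simpa [f] using this
  have hle : LinearMap.range A.mulVecLin ≤ LinearMap.ker f := by
    rintro _ ⟨u, rfl⟩
    change w ⬝ᵥ (A *ᵥ u) = 0
    rw [Matrix.dotProduct_mulVec, hw, zero_dotProduct]
  -- By rank-nullity the range has codimension at most one, while it lies in the hyperplane $w^\top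
  -- y=0$; so the two agree.
  have h₁ := A.mulVecLin.finrank_range_add_finrank_ker
  have h₂ := Module.Dual.finrank_ker_add_one_of_ne_zero hf
  have h₃ : Module.finrank ℂ ↥(LinearMap.ker A.mulVecLin) ≤ 1 := by
    refine (Submodule.finrank_mono (t := Submodule.span ℂ {v}) fun u hu => ?_).trans
      ((finrank_span_le_card ({v} : Set (ι → ℂ))).trans (by simp))
    exact Submodule.mem_span_singleton.mpr (hker u hu)
  have heq := Submodule.eq_of_le_of_finrank_le hle (by omega)
  have : y ∈ LinearMap.range A.mulVecLin := heq ▸ (show y ∈ LinearMap.ker f from hy)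
  exact this

theorem HasDerivAt.dotProduct_mulVec {ι : Type*} [Fintype ι] {f g : ℝ → ι → ℂ} {f' g' : ι → ℂ}
    {t : ℝ} (A : Matrix ι ι ℂ) (hf : HasDerivAt f f' t) (hg : HasDerivAt g g' t) :
    HasDerivAt (fun s => f s ⬝ᵥ (A *ᵥ g s)) (f' ⬝ᵥ (A *ᵥ g t) + f t ⬝ᵥ (A *ᵥ g')) t := by
  have hf' := hasDerivAt_pi.mp hf
  have hg' := hasDerivAt_pi.mp hg
  have hA : ∀ i, HasDerivAt (fun s => (A *ᵥ g s) i) ((A *ᵥ g') i) t := fun i => by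
    simp only [Matrix.mulVec, dotProduct]
    exact HasDerivAt.fun_sum fun j _ => (hg' j).const_mul (A i j)
  simp only [dotProduct, ← Finset.sum_add_distrib]
  exact HasDerivAt.fun_sum fun i _ => (hf' i).mul (hA i)

/-! ### Evaluation, restriction and the operator $\mathcal H$ -/

namespace HamDelaySystem

variable {n K : ℕ} (S : HamDelaySystem n K)

theorem τ_le_last {k : ℕ} (hk : k ∈ Set.Icc 1 K) : S.τ k ≤ S.τ K :=
  S.τ_strictMono.monotoneOn hk ⟨S.one_le_K, le_rfl⟩ hk.2

theorem zero_mem_dom : (0 : ℝ) ∈ S.dom :=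
  ⟨by linarith [S.τ_last_pos], S.τ_last_pos.le⟩

theorem τ_mem_dom {k : ℕ} (hk : k ∈ Set.Icc 1 K) : S.τ k ∈ S.dom :=
  ⟨by linarith [S.τ_last_pos, S.τ_pos k hk], S.τ_le_last hk⟩

theorem neg_τ_mem_dom {k : ℕ} (hk : k ∈ Set.Icc 1 K) : -S.τ k ∈ S.dom :=
  ⟨by linarith [S.τ_le_last hk], by linarith [S.τ_last_pos, S.τ_pos k hk]⟩

@[fun_prop]
theorem continuous_ev (φ : S.X) : Continuous (S.ev φ) :=
  φ.continuous.comp continuous_projIcc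

theorem ev_coe (φ : S.X) (t : S.dom) : S.ev φ t = φ t := by
  simp [ev]

theorem ev_add (φ ψ : S.X) (t : ℝ) : S.ev (φ + ψ) t = S.ev φ t + S.ev ψ t := rfl

theorem ev_smul (c : ℂ) (φ : S.X) (t : ℝ) : S.ev (c • φ) t = c • S.ev φ t := rfl

theorem ev_applyJ (φ : S.X) (t : ℝ) : S.ev (S.applyJ φ) t = hamJ n ℂ *ᵥ S.ev φ t := rfl

/-- The restriction of a continuous function on the real line to `[-τ_K, τ_K]`. -/
def restr (g : ℝ → Fin n ⊕ Fin n → ℂ) (hg : Continuous g) : S.X :=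
  ⟨fun t => g t, hg.comp continuous_subtype_val⟩

theorem ev_restr {g : ℝ → Fin n ⊕ Fin n → ℂ} (hg : Continuous g) {t : ℝ} (ht : t ∈ S.dom) :
    S.ev (S.restr g hg) t = g t := by
  have h := S.ev_coe (S.restr g hg) ⟨t, ht⟩
  exact h

theorem boundaryMap_restr {g : ℝ → Fin n ⊕ Fin n → ℂ} (hg : Continuous g) :
    S.boundaryMap (S.restr g hg) = S.Hc 0 *ᵥ g 0 + ∑ k ∈ Finset.Icc 1 K,
      (S.Hc (-(k : ℤ)) *ᵥ g (-(S.τ k)) + S.Hc (k : ℤ) *ᵥ g (S.τ k)) := by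
  unfold boundaryMap
  rw [S.ev_restr hg S.zero_mem_dom]
  congr 1
  refine Finset.sum_congr rfl fun k hk => ?_
  have hk' : k ∈ Set.Icc 1 K := by simpa using hk
  rw [S.ev_restr hg (S.τ_mem_dom hk'), S.ev_restr hg (S.neg_τ_mem_dom hk')]

theorem isDeriv_op (φ : S.op.domain) : S.IsDeriv φ (S.op φ) :=
  φ.2.choose_spec.1

theorem ev_op_zero (φ : S.op.domain) : S.ev (S.op φ) 0 = S.boundaryMap φ :=
  φ.2.choose_spec.2

theorem mem_op_domain {φ ψ : S.X} (h : S.IsDeriv φ ψ) (hb : S.ev ψ 0 = S.boundaryMap φ) :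
    φ ∈ S.op.domain :=
  ⟨ψ, h, hb⟩

theorem op_eq {φ : S.op.domain} {ψ : S.X} (h : S.IsDeriv φ ψ) : S.op φ = ψ :=
  (S.isDeriv_op φ).unique h

/-! ### Exponential functions and the characteristic matrix -/

theorem hasDerivAt_exp_mul_ofReal (z : ℂ) (t : ℝ) :
    HasDerivAt (fun s : ℝ => Complex.exp (z * (s : ℂ))) (z * Complex.exp (z * (t : ℂ))) t := by
  have h : HasDerivAt (fun s : ℝ => z * (s : ℂ)) z t := by
    simpa using (Complex.ofRealCLM.hasDerivAt (x := t)).const_mul z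
  simpa [mul_comm] using h.cexp

theorem continuous_exp_smul (z : ℂ) {f : ℝ → Fin n ⊕ Fin n → ℂ} (hf : Continuous f) :
    Continuous fun t : ℝ => Complex.exp (z * (t : ℂ)) • f t := by
  fun_prop

/-- The derivative of $e^{zt}c$ at $0$ is $zc$, so $M(z)c$ measures how far this function is from
satisfying the condition that defines $D(\mathcal H)$. -/
theorem charMatrix_mulVec (z : ℂ) (c : Fin n ⊕ Fin n → ℂ) :
    S.charMatrix z *ᵥ c = z • c - S.boundaryMap
      (S.restr (fun t => Complex.exp (z * (t : ℂ)) • c) (continuous_exp_smul z continuous_const)) := by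
  rw [boundaryMap_restr, charMatrix]
  simp only [Matrix.sub_mulVec, Matrix.smul_mulVec, Matrix.one_mulVec, Matrix.sum_mulVec,
    Matrix.add_mulVec, Matrix.mulVec_smul, Complex.ofReal_zero, mul_zero, Complex.exp_zero,
    one_smul, Complex.ofReal_neg, mul_neg, neg_mul, sub_sub]

/-- The exponential function `t ↦ exp (z t) c`. -/
def expFun (z : ℂ) (c : Fin n ⊕ Fin n → ℂ) : S.X :=
  S.restr (fun t => Complex.exp (z * (t : ℂ)) • c) (continuous_exp_smul z continuous_const)

theorem ev_expFun (z : ℂ) (c : Fin n ⊕ Fin n → ℂ) {t : ℝ} (ht : t ∈ S.dom) :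
    S.ev (S.expFun z c) t = Complex.exp (z * (t : ℂ)) • c :=
  S.ev_restr _ ht

theorem ev_expFun_zero (z : ℂ) (c : Fin n ⊕ Fin n → ℂ) : S.ev (S.expFun z c) 0 = c := by
  rw [S.ev_expFun z c S.zero_mem_dom]; simp

theorem boundaryMap_expFun (z : ℂ) (c : Fin n ⊕ Fin n → ℂ) :
    S.boundaryMap (S.expFun z c) = z • c - S.charMatrix z *ᵥ c := by
  rw [charMatrix_mulVec, sub_sub_cancel]; rfl

/-- `IsDeriv` for a product with an exponential, with the derivative checked on `[-τ_K, τ_K]`. -/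
theorem isDeriv_exp_smul (z : ℂ) {f : ℝ → Fin n ⊕ Fin n → ℂ} (hf : Continuous f)
    {f' : ℝ → Fin n ⊕ Fin n → ℂ} (hf' : ∀ t, HasDerivAt f (f' t) t) (ψ : S.X)
    (hψ : ∀ t ∈ S.dom, S.ev ψ t = Complex.exp (z * (t : ℂ)) • (z • f t + f' t)) :
    S.IsDeriv (S.restr (fun t => Complex.exp (z * (t : ℂ)) • f t) (continuous_exp_smul z hf)) ψ := by
  intro t ht
  have h := (hasDerivAt_exp_mul_ofReal z t).smul (hf' t)
  refine (h.hasDerivWithinAt.congr (fun s hs => S.ev_restr _ hs) (S.ev_restr _ ht)).congr_deriv ?_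
  rw [hψ t ht]
  simp only [smul_add, smul_smul, mul_comm z]
  abel

theorem isDeriv_expFun (z : ℂ) (c : Fin n ⊕ Fin n → ℂ) :
    S.IsDeriv (S.expFun z c) (z • S.expFun z c) :=
  S.isDeriv_exp_smul z continuous_const (fun t => hasDerivAt_const t c) _ fun t ht => by
    rw [ev_smul, S.ev_expFun z c ht, add_zero, smul_comm]

theorem expFun_mem_op_domain {z : ℂ} {c : Fin n ⊕ Fin n → ℂ} (h : S.charMatrix z *ᵥ c = 0) :
    S.expFun z c ∈ S.op.domain :=
  S.mem_op_domain (S.isDeriv_expFun z c) <| by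
    rw [ev_smul, ev_expFun_zero, boundaryMap_expFun, h, sub_zero]

theorem expFun_ne_zero {z : ℂ} {c : Fin n ⊕ Fin n → ℂ} (hc : c ≠ 0) : S.expFun z c ≠ 0 :=
  fun h => hc <| by rw [← S.ev_expFun_zero z c, h]; rfl

theorem isEigenpair_expFun {z : ℂ} {c : Fin n ⊕ Fin n → ℂ} (hc : c ≠ 0)
    (h : S.charMatrix z *ᵥ c = 0) : S.op.IsEigenpair z (S.expFun z c) :=
  ⟨S.expFun_ne_zero hc, S.expFun_mem_op_domain h, S.op_eq (S.isDeriv_expFun z c)⟩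

theorem eq_expFun_of_isDeriv {z : ℂ} {φ : S.X} (h : S.IsDeriv φ (z • φ)) :
    φ = S.expFun z (S.ev φ 0) := by
  -- The integrating factor $e^{-zt}$ turns $\varphi'=z\varphi$ into constancy of
  -- $e^{-zt}\varphi(t)$.
  have hderiv : ∀ t ∈ S.dom, HasDerivWithinAt
      (fun s : ℝ => Complex.exp (-z * (s : ℂ)) • S.ev φ s) 0 S.dom t := fun t ht => by
    refine ((hasDerivAt_exp_mul_ofReal (-z) t).hasDerivWithinAt.smul (h t ht)).congr_deriv ?_
    rw [ev_smul, smul_smul, ← add_smul]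
    simp [mul_comm]
  have hconst := constant_of_has_deriv_right_zero
    (fun t ht => (hderiv t ht).continuousWithinAt) (fun t ht =>
      (hderiv t ⟨ht.1, ht.2.le⟩).mono_of_mem_nhdsWithin (Icc_mem_nhdsGE_of_mem ht))
  ext1 t
  have h₁ := (hconst t t.2).trans (hconst 0 S.zero_mem_dom).symm
  simp only [Complex.ofReal_zero, mul_zero, Complex.exp_zero, one_smul] at h₁
  rw [← S.ev_coe (S.expFun _ _), S.ev_expFun _ _ t.2, ← h₁, smul_smul, ← Complex.exp_add, ev_coe]
  simp

/-- Eigenfunctions are exponential functions with a coefficient in the kernel of the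
characteristic matrix. -/
theorem exists_eq_expFun_of_isEigenpair {z : ℂ} {φ : S.X} (h : S.op.IsEigenpair z φ) :
    ∃ c, c ≠ 0 ∧ S.charMatrix z *ᵥ c = 0 ∧ φ = S.expFun z c := by
  obtain ⟨h0, hφ, he⟩ := h
  have hd := S.isDeriv_op ⟨φ, hφ⟩
  have hb := S.ev_op_zero ⟨φ, hφ⟩
  rw [he] at hd hb
  have heq : φ = S.expFun z (S.ev φ 0) := S.eq_expFun_of_isDeriv hd
  refine ⟨S.ev φ 0, fun hc => h0 ?_, ?_, heq⟩
  · rw [heq, hc]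
    ext t i
    simp [expFun, restr]
  · change S.ev (z • φ) 0 = S.boundaryMap φ at hb
    rw [ev_smul] at hb
    have hb' := S.boundaryMap_expFun z (S.ev φ 0)
    rw [← heq, ← hb] at hb'
    exact sub_eq_self.mp hb'.symm

/-! ### The resolvent -/

/-- Variation of constants: the solutions of $\varphi'=\sigma\varphi+f$ are $e^{\sigma t}c+\chi(t)$
with $\chi(t)=e^{\sigma t}\int_0^t e^{-\sigma s}f(s)\,ds$. Only $c$ remains to be chosen, and
$M(\sigma)$ is invertible because $\sigma$ is not an eigenvalue. -/
theorem exists_op_sub_smul_eq {σ : ℂ} (hσ : ¬ S.op.IsEigenvalue σ) (f : S.X) :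
    ∃ φ : S.op.domain, S.op φ - σ • (φ : S.X) = f := by
  have hinj : Function.Injective (S.charMatrix σ).mulVecLin := by
    refine (injective_iff_map_eq_zero _).mpr fun c hc => ?_
    by_contra h0
    exact hσ ⟨_, S.isEigenpair_expFun h0 hc⟩
  have hsurj := LinearMap.injective_iff_surjective.mp hinj
  have hgc : Continuous fun s : ℝ => Complex.exp (-σ * (s : ℂ)) • S.ev f s :=
    continuous_exp_smul _ (S.continuous_ev f)
  let F : ℝ → Fin n ⊕ Fin n → ℂ := fun t =>
    ∫ s in (0 : ℝ)..t, Complex.exp (-σ * (s : ℂ)) • S.ev f s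
  have hF : ∀ t : ℝ, HasDerivAt F (Complex.exp (-σ * (t : ℂ)) • S.ev f t) t := fun t =>
    hgc.integral_hasStrictDerivAt 0 t |>.hasDerivAt
  have hFc : Continuous F := continuous_iff_continuousAt.mpr fun t => (hF t).continuousAt
  have hF0 : F 0 = 0 := intervalIntegral.integral_same
  let χ : S.X := S.restr (fun t => Complex.exp (σ * (t : ℂ)) • F t) (continuous_exp_smul σ hFc)
  have hχ0 : S.ev χ 0 = 0 := by
    rw [S.ev_restr _ S.zero_mem_dom, hF0, smul_zero]
  have hχ : S.IsDeriv χ (σ • χ + f) := S.isDeriv_exp_smul σ hFc hF _ fun t ht => by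
    rw [ev_add, ev_smul, S.ev_restr _ ht, smul_add, smul_smul (Complex.exp _) (Complex.exp _) (S.ev f t),
      ← Complex.exp_add, smul_comm]
    simp
  -- Since $\chi(0)=0$, the condition at $0$ for $e^{\sigma t}c+\chi$ is exactly this linear system
  -- for $c$.
  obtain ⟨c, hc⟩ := hsurj (S.boundaryMap χ - S.ev f 0)
  change S.charMatrix σ *ᵥ c = _ at hc
  have hd : S.IsDeriv (S.expFun σ c + χ) (σ • S.expFun σ c + (σ • χ + f)) :=
    (S.isDeriv_expFun σ c).add hχ
  refine ⟨⟨S.expFun σ c + χ, S.mem_op_domain hd ?_⟩, ?_⟩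
  · rw [boundaryMap_add, boundaryMap_expFun, hc]
    simp only [ev_add, ev_smul, ev_expFun_zero, hχ0]
    module
  · rw [S.op_eq hd]
    change _ - σ • (S.expFun σ c + χ) = f
    module

theorem eq_zero_of_op_eq_smul {σ : ℂ} (hσ : ¬ S.op.IsEigenvalue σ) {φ : S.op.domain}
    (h : S.op φ = σ • (φ : S.X)) : φ = 0 := by
  by_contra h0
  exact hσ ⟨φ, fun h => h0 (Subtype.ext h), φ.2, h⟩

/-! ### Hamiltonian symmetry of the characteristic matrix -/

theorem hamJ_mul_Hc (k : ℤ) : hamJ n ℂ * S.Hc k = (hamJ n ℝ * S.H k).map Complex.ofReal := by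
  rw [← hamJ_map, Hc]
  exact (Matrix.map_mul (f := Complex.ofRealHom)).symm

theorem hamJ_mul_Hc_zero_transpose : (hamJ n ℂ * S.Hc 0)ᵀ = hamJ n ℂ * S.Hc 0 := by
  rw [hamJ_mul_Hc, ← Matrix.transpose_map, S.ham_zero]

theorem hamJ_mul_Hc_neg_transpose {k : ℕ} (hk : k ∈ Set.Icc 1 K) :
    (hamJ n ℂ * S.Hc (-(k : ℤ)))ᵀ = hamJ n ℂ * S.Hc k := by
  rw [hamJ_mul_Hc, ← Matrix.transpose_map, S.ham k hk, hamJ_mul_Hc]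

theorem hamJ_mul_Hc_transpose {k : ℕ} (hk : k ∈ Set.Icc 1 K) :
    (hamJ n ℂ * S.Hc k)ᵀ = hamJ n ℂ * S.Hc (-(k : ℤ)) := by
  rw [← S.hamJ_mul_Hc_neg_transpose hk, Matrix.transpose_transpose]

/-- Transposition flips the sign of $zJ$ and exchanges $JH_{-k}$ with $JH_k$, which has the same
effect as replacing $z$ by $-z$. -/
theorem hamJ_mul_charMatrix_transpose (z : ℂ) :
    (hamJ n ℂ * S.charMatrix z)ᵀ = hamJ n ℂ * S.charMatrix (-z) := by
  simp only [charMatrix, Matrix.mul_sub, Matrix.mul_sum, Matrix.mul_add, Matrix.mul_smul,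
    Matrix.mul_one, Matrix.transpose_sub, Matrix.transpose_sum, Matrix.transpose_add,
    Matrix.transpose_smul, hamJ_mul_Hc_zero_transpose, hamJ_transpose, neg_neg, smul_neg, neg_smul]
  rw [Matrix.mul_neg, Matrix.mul_smul, Matrix.mul_one, sub_right_inj]
  refine Finset.sum_congr rfl fun k hk => ?_
  have hk' : k ∈ Set.Icc 1 K := by simpa using hk
  rw [S.hamJ_mul_Hc_neg_transpose hk', S.hamJ_mul_Hc_transpose hk', add_comm]

theorem vecMul_charMatrix_eq_zero {z : ℂ} {w : Fin n ⊕ Fin n → ℂ}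
    (h : S.charMatrix (-z) *ᵥ (hamJ n ℂ *ᵥ w) = 0) : w ᵥ* S.charMatrix z = 0 := by
  have h₁ := congrArg (hamJ n ℂ *ᵥ ·) h
  simp only [Matrix.mulVec_zero] at h₁
  rw [Matrix.mulVec_mulVec, ← hamJ_mul_charMatrix_transpose, Matrix.transpose_mul, hamJ_transpose,
    Matrix.mul_neg, Matrix.neg_mulVec, ← Matrix.mulVec_mulVec, hamJ_mulVec_hamJ_mulVec,
    Matrix.mulVec_neg, neg_neg, Matrix.mulVec_transpose] at h₁
  exact h₁

/-- A right null vector of $M(-\sigma)$ gives a left null vector of $M(\sigma)$, and a square matrix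
with one also has a right null vector. This makes both factors of $\mathcal R_\sigma$ invertible. -/
theorem not_isEigenvalue_neg {σ : ℂ} (hσ : ¬ S.op.IsEigenvalue σ) :
    ¬ S.op.IsEigenvalue (-σ) := by
  rintro ⟨φ, hφ⟩
  obtain ⟨c, hc0, hc, -⟩ := S.exists_eq_expFun_of_isEigenpair hφ
  have hw : (-(hamJ n ℂ *ᵥ c)) ᵥ* S.charMatrix σ = 0 := S.vecMul_charMatrix_eq_zero <| by
    rw [Matrix.mulVec_neg, hamJ_mulVec_hamJ_mulVec, neg_neg, hc]
  have hw0 : -(hamJ n ℂ *ᵥ c) ≠ 0 := fun h => hc0 <| by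
    rw [← neg_eq_zero, ← hamJ_mulVec_hamJ_mulVec c, neg_eq_zero.mp h, Matrix.mulVec_zero]
  have hdet := Matrix.exists_vecMul_eq_zero_iff.mp ⟨_, hw0, hw⟩
  obtain ⟨v, hv0, hv⟩ := Matrix.exists_mulVec_eq_zero_iff.mpr hdet
  exact hσ ⟨_, S.isEigenpair_expFun hv0 hv⟩

/-! ### The operator `R_σ` -/

theorem mem_shiftOp_domain {σ : ℂ} {x : S.X} (hx : x ∈ S.op.domain)
    (hx' : S.op ⟨x, hx⟩ + σ • x ∈ S.op.domain) : x ∈ (S.shiftOp σ).domain :=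
  ⟨⟨⟨x, hx⟩, hx', rfl⟩, hx⟩

theorem exists_shiftOp_eq {σ : ℂ} (x : (S.shiftOp σ).domain) :
    ∃ (hx : (x : S.X) ∈ S.op.domain) (hy : S.op ⟨x, hx⟩ + σ • (x : S.X) ∈ S.op.domain),
      S.shiftOp σ x = S.op ⟨_, hy⟩ - σ • (S.op ⟨x, hx⟩ + σ • (x : S.X)) := by
  obtain ⟨x, ⟨x', hx', e⟩, hx⟩ := x
  obtain rfl : (x' : S.X) = x := e
  refine ⟨hx, hx', ?_⟩
  rw [sub_eq_add_neg, ← neg_smul σ (_ : S.X)]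
  rfl

theorem shiftOp_bijective {σ : ℂ} (hσ : ¬ S.op.IsEigenvalue σ) :
    Function.Bijective (S.shiftOp σ).toFun := by
  have hσ' := S.not_isEigenvalue_neg hσ
  constructor
  · refine (injective_iff_map_eq_zero _).mpr fun x h => ?_
    obtain ⟨hx, hy, e⟩ := S.exists_shiftOp_eq x
    have h₁ := S.eq_zero_of_op_eq_smul hσ (sub_eq_zero.mp (e.symm.trans h))
    have h₂ := S.eq_zero_of_op_eq_smul hσ' (φ := ⟨x, hx⟩) <| by
      rw [neg_smul σ (x : S.X)]
      exact eq_neg_of_add_eq_zero_left (congrArg Subtype.val h₁)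
    exact Subtype.ext (congrArg (fun u : S.op.domain => (u : S.X)) h₂)
  · intro f
    obtain ⟨y, hy⟩ := S.exists_op_sub_smul_eq hσ f
    obtain ⟨x, hx⟩ := S.exists_op_sub_smul_eq hσ' (y : S.X)
    rw [neg_smul σ (x : S.X), sub_neg_eq_add] at hx
    refine ⟨⟨x, S.mem_shiftOp_domain x.2 (hx ▸ y.2)⟩, ?_⟩
    obtain ⟨_, hz, e⟩ := S.exists_shiftOp_eq ⟨x, S.mem_shiftOp_domain x.2 (hx ▸ y.2)⟩
    refine e.trans ?_
    have hzy : (⟨_, hz⟩ : S.op.domain) = y := Subtype.ext hx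
    rw [hzy]
    exact (congrArg (fun u => S.op y - σ • u) hx).trans hy

theorem exists_shiftInv_eq {σ : ℂ} (hσ : ¬ S.op.IsEigenvalue σ) (f : S.X) :
    ∃ x : (S.shiftOp σ).domain, S.shiftOp σ x = f ∧ S.shiftInv σ f = x := by
  have h := S.shiftOp_bijective hσ
  refine ⟨(LinearEquiv.ofBijective (S.shiftOp σ).toFun h).symm f,
    (LinearEquiv.ofBijective (S.shiftOp σ).toFun h).apply_symm_apply f, ?_⟩
  rw [shiftInv, dif_pos h]
  rfl

/-! ### The skew-symmetric form `⟨φ, Jψ⟩` -/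

/-- The delay term `∫₀^τₖ φ(θ)ᵀ J H₋ₖ ψ(θ - τₖ) dθ`. -/
def delayTerm (k : ℕ) (φ ψ : S.X) : ℂ :=
  ∫ θ in (0 : ℝ)..S.τ k, S.ev φ θ ⬝ᵥ ((hamJ n ℂ * S.Hc (-(k : ℤ))) *ᵥ S.ev ψ (θ - S.τ k))

@[fun_prop]
theorem continuous_ev_dotProduct_mulVec (φ ψ : S.X) (a b : ℝ)
    (A : Matrix (Fin n ⊕ Fin n) (Fin n ⊕ Fin n) ℂ) :
    Continuous fun θ => S.ev φ (θ - a) ⬝ᵥ (A *ᵥ S.ev ψ (θ - b)) :=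
  Continuous.dotProduct (by fun_prop) (Continuous.matrix_mulVec continuous_const (by fun_prop))

theorem intervalIntegrable_delayTerm (k : ℕ) (φ ψ : S.X) :
    IntervalIntegrable (fun θ => S.ev φ θ ⬝ᵥ
      ((hamJ n ℂ * S.Hc (-(k : ℤ))) *ᵥ S.ev ψ (θ - S.τ k))) MeasureTheory.volume 0 (S.τ k) := by
  have h := S.continuous_ev_dotProduct_mulVec φ ψ 0 (S.τ k) (hamJ n ℂ * S.Hc (-(k : ℤ)))
  simp only [sub_zero] at h
  exact h.intervalIntegrable _ _

/-- The identity $(JH_{-k})^\top=JH_k$ turns the second integral into the first with the arguments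
exchanged, which makes the skew-symmetry visible. -/
theorem bilin_applyJ (φ ψ : S.X) :
    S.bilin φ (S.applyJ ψ) = -(S.ev ψ 0 ⬝ᵥ (hamJ n ℂ *ᵥ S.ev φ 0)) +
      ∑ k ∈ Finset.Icc 1 K, (S.delayTerm k φ ψ - S.delayTerm k ψ φ) := by
  unfold bilin
  simp only [ev_applyJ, hamJ_mulVec_dotProduct, Matrix.mulVec_mulVec,
    intervalIntegral.integral_neg, sub_neg_eq_add]
  congr 1
  refine Finset.sum_congr rfl fun k hk => ?_
  have hk' : k ∈ Set.Icc 1 K := by simpa using hk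
  rw [neg_add_eq_sub]
  congr 1
  refine intervalIntegral.integral_congr fun θ _ => ?_
  rw [← S.hamJ_mul_Hc_neg_transpose hk', Matrix.mulVec_transpose, dotProduct_comm,
    ← Matrix.dotProduct_mulVec]

theorem delayTerm_add_left (k : ℕ) (φ₁ φ₂ ψ : S.X) :
    S.delayTerm k (φ₁ + φ₂) ψ = S.delayTerm k φ₁ ψ + S.delayTerm k φ₂ ψ := by
  simp only [delayTerm, ev_add, add_dotProduct]
  exact intervalIntegral.integral_add (S.intervalIntegrable_delayTerm k φ₁ ψ)
    (S.intervalIntegrable_delayTerm k φ₂ ψ)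

theorem delayTerm_add_right (k : ℕ) (φ ψ₁ ψ₂ : S.X) :
    S.delayTerm k φ (ψ₁ + ψ₂) = S.delayTerm k φ ψ₁ + S.delayTerm k φ ψ₂ := by
  simp only [delayTerm, ev_add, Matrix.mulVec_add, dotProduct_add]
  exact intervalIntegral.integral_add (S.intervalIntegrable_delayTerm k φ ψ₁)
    (S.intervalIntegrable_delayTerm k φ ψ₂)

theorem delayTerm_smul_left (k : ℕ) (c : ℂ) (φ ψ : S.X) :
    S.delayTerm k (c • φ) ψ = c * S.delayTerm k φ ψ := by
  simp only [delayTerm, ev_smul, smul_dotProduct, smul_eq_mul,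
    intervalIntegral.integral_const_mul]

theorem delayTerm_smul_right (k : ℕ) (c : ℂ) (φ ψ : S.X) :
    S.delayTerm k φ (c • ψ) = c * S.delayTerm k φ ψ := by
  simp only [delayTerm, ev_smul, Matrix.mulVec_smul, dotProduct_smul, smul_eq_mul,
    intervalIntegral.integral_const_mul]

/-- The bilinear form `(φ, ψ) ↦ ⟨φ, Jψ⟩`. -/
def skewForm : S.X →ₗ[ℂ] S.X →ₗ[ℂ] ℂ :=
  LinearMap.mk₂ ℂ (fun φ ψ => S.bilin φ (S.applyJ ψ))
    (fun φ₁ φ₂ ψ => by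
      simp only [bilin_applyJ, delayTerm_add_left, delayTerm_add_right, ev_add,
        Matrix.mulVec_add, dotProduct_add, Finset.sum_add_distrib, Finset.sum_sub_distrib]
      ring)
    (fun c φ ψ => by
      simp only [bilin_applyJ, delayTerm_smul_left, delayTerm_smul_right, ev_smul,
        Matrix.mulVec_smul, dotProduct_smul, Finset.sum_sub_distrib, smul_eq_mul,
        ← Finset.mul_sum]
      ring)
    (fun φ ψ₁ ψ₂ => by
      simp only [bilin_applyJ, delayTerm_add_left, delayTerm_add_right, ev_add,
        add_dotProduct, Finset.sum_add_distrib, Finset.sum_sub_distrib]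
      ring)
    (fun c φ ψ => by
      simp only [bilin_applyJ, delayTerm_smul_left, delayTerm_smul_right, ev_smul,
        smul_dotProduct, Finset.sum_sub_distrib, smul_eq_mul, ← Finset.mul_sum]
      ring)

theorem skewForm_apply (φ ψ : S.X) : S.skewForm φ ψ = S.bilin φ (S.applyJ ψ) := rfl

theorem dotProduct_hamJ_mulVec_comm (x y : Fin n ⊕ Fin n → ℂ) :
    x ⬝ᵥ (hamJ n ℂ *ᵥ y) = -(y ⬝ᵥ (hamJ n ℂ *ᵥ x)) := by
  rw [← hamJ_mulVec_dotProduct, dotProduct_comm]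

theorem skewForm_swap (φ ψ : S.X) : S.skewForm φ ψ = -S.skewForm ψ φ := by
  simp only [skewForm_apply, bilin_applyJ, Finset.sum_sub_distrib]
  rw [dotProduct_hamJ_mulVec_comm (S.ev φ 0)]
  ring

theorem IsDeriv.hasDerivAt {S : HamDelaySystem n K} {φ ψ : S.X} (h : S.IsDeriv φ ψ) {t : ℝ}
    (h₁ : -(S.τ K) < t) (h₂ : t < S.τ K) : HasDerivAt (S.ev φ) (S.ev ψ t) t :=
  (h t ⟨h₁.le, h₂.le⟩).hasDerivAt (Icc_mem_nhds h₁ h₂)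

/-- Integration by parts for $\theta\mapsto\varphi(\theta)^\top JH_{-k}\psi(\theta-\tau_k)$.
Derivatives are needed only on the open interval, so the one-sided ones at $\pm\tau_K$ do not enter.
-/
theorem delayTerm_deriv {k : ℕ} (hk : k ∈ Set.Icc 1 K) {φ φ' ψ ψ' : S.X} (hφ : S.IsDeriv φ φ')
    (hψ : S.IsDeriv ψ ψ') : S.delayTerm k φ' ψ + S.delayTerm k φ ψ' =
      S.ev φ (S.τ k) ⬝ᵥ ((hamJ n ℂ * S.Hc (-(k : ℤ))) *ᵥ S.ev ψ 0) -
        S.ev φ 0 ⬝ᵥ ((hamJ n ℂ * S.Hc (-(k : ℤ))) *ᵥ S.ev ψ (-S.τ k)) := by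
  have hpos := S.τ_pos k hk
  have hle := S.τ_le_last hk
  have hcont := S.continuous_ev_dotProduct_mulVec φ ψ 0 (S.τ k) (hamJ n ℂ * S.Hc (-(k : ℤ)))
  simp only [sub_zero] at hcont
  unfold delayTerm
  rw [← intervalIntegral.integral_add (S.intervalIntegrable_delayTerm k φ' ψ)
    (S.intervalIntegrable_delayTerm k φ ψ')]
  have h := intervalIntegral.integral_eq_sub_of_hasDerivAt_of_le hpos.le hcont.continuousOn
    (fun θ hθ => HasDerivAt.dotProduct_mulVec (hamJ n ℂ * S.Hc (-(k : ℤ)))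
      (hφ.hasDerivAt (t := θ) (by linarith [hθ.1]) (by linarith [hθ.2]))
      ((hψ.hasDerivAt (t := θ - S.τ k) (by linarith [hθ.1]) (by linarith [hθ.2])).comp_sub_const
        θ (S.τ k)))
    ((S.intervalIntegrable_delayTerm k φ' ψ).add (S.intervalIntegrable_delayTerm k φ ψ'))
  rw [h, sub_self, zero_sub]

/-- Every $H_k$ is transposed into $H_{-k}$ so that the summands match the boundary terms of
`delayTerm_deriv`. -/
theorem dotProduct_hamJ_mulVec_boundaryMap (x : Fin n ⊕ Fin n → ℂ) (φ : S.X) :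
    x ⬝ᵥ (hamJ n ℂ *ᵥ S.boundaryMap φ) = x ⬝ᵥ ((hamJ n ℂ * S.Hc 0) *ᵥ S.ev φ 0) +
      ∑ k ∈ Finset.Icc 1 K, (x ⬝ᵥ ((hamJ n ℂ * S.Hc (-(k : ℤ))) *ᵥ S.ev φ (-S.τ k)) +
        S.ev φ (S.τ k) ⬝ᵥ ((hamJ n ℂ * S.Hc (-(k : ℤ))) *ᵥ x)) := by
  unfold boundaryMap
  rw [Matrix.mulVec_add, dotProduct_add, Matrix.mulVec_mulVec, Matrix.mulVec_sum,
    dotProduct_sum]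
  congr 1
  refine Finset.sum_congr rfl fun k hk => ?_
  have hk' : k ∈ Set.Icc 1 K := by simpa using hk
  rw [Matrix.mulVec_add, dotProduct_add, Matrix.mulVec_mulVec, Matrix.mulVec_mulVec]
  congr 1
  rw [← S.hamJ_mul_Hc_neg_transpose hk', Matrix.mulVec_transpose, dotProduct_comm,
    ← Matrix.dotProduct_mulVec]

/-- The operator `𝓗` is skew-symmetric for the form `⟨φ, Jψ⟩`. -/
theorem skewForm_op (φ ψ : S.op.domain) :
    S.skewForm (S.op φ) ψ = -S.skewForm φ (S.op ψ) := by
  have h₀ : S.ev (ψ : S.X) 0 ⬝ᵥ ((hamJ n ℂ * S.Hc 0) *ᵥ S.ev (φ : S.X) 0) =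
      S.ev (φ : S.X) 0 ⬝ᵥ ((hamJ n ℂ * S.Hc 0) *ᵥ S.ev (ψ : S.X) 0) := by
    conv_lhs => rw [← S.hamJ_mul_Hc_zero_transpose, Matrix.mulVec_transpose, dotProduct_comm,
      ← Matrix.dotProduct_mulVec]
  rw [← sub_eq_zero, sub_neg_eq_add]
  simp only [skewForm_apply, bilin_applyJ]
  rw [dotProduct_hamJ_mulVec_comm (S.ev (S.op ψ) 0), ev_op_zero, ev_op_zero,
    dotProduct_hamJ_mulVec_boundaryMap, dotProduct_hamJ_mulVec_boundaryMap, h₀]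
  -- The $H_0$ terms cancel by `h₀`; integrating by parts in both orders produces the delayed terms
  -- that cancel those from the values at $0$.
  have hsum : ∑ k ∈ Finset.Icc 1 K, (S.delayTerm k (S.op φ) ψ - S.delayTerm k ψ (S.op φ)) +
      ∑ k ∈ Finset.Icc 1 K, (S.delayTerm k φ (S.op ψ) - S.delayTerm k (S.op ψ) φ) =
      ∑ k ∈ Finset.Icc 1 K,
        (S.ev (ψ : S.X) 0 ⬝ᵥ ((hamJ n ℂ * S.Hc (-(k : ℤ))) *ᵥ S.ev (φ : S.X) (-S.τ k)) +
        S.ev (φ : S.X) (S.τ k) ⬝ᵥ ((hamJ n ℂ * S.Hc (-(k : ℤ))) *ᵥ S.ev (ψ : S.X) 0)) -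
      ∑ k ∈ Finset.Icc 1 K,
        (S.ev (φ : S.X) 0 ⬝ᵥ ((hamJ n ℂ * S.Hc (-(k : ℤ))) *ᵥ S.ev (ψ : S.X) (-S.τ k)) +
        S.ev (ψ : S.X) (S.τ k) ⬝ᵥ ((hamJ n ℂ * S.Hc (-(k : ℤ))) *ᵥ S.ev (φ : S.X) 0)) := by
    rw [← Finset.sum_add_distrib, ← Finset.sum_sub_distrib]
    refine Finset.sum_congr rfl fun k hk => ?_
    have hk' : k ∈ Set.Icc 1 K := by simpa using hk
    have h₁ := S.delayTerm_deriv hk' (S.isDeriv_op φ) (S.isDeriv_op ψ)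
    have h₂ := S.delayTerm_deriv hk' (S.isDeriv_op ψ) (S.isDeriv_op φ)
    linear_combination h₁ - h₂
  linear_combination hsum

theorem skewForm_shiftInv {σ : ℂ} (hσ : ¬ S.op.IsEigenvalue σ) (f g : S.X) :
    S.skewForm (S.shiftInv σ f) g = S.skewForm f (S.shiftInv σ g) := by
  obtain ⟨x, hx, hx'⟩ := S.exists_shiftInv_eq hσ f
  obtain ⟨y, hy, hy'⟩ := S.exists_shiftInv_eq hσ g
  obtain ⟨hx₁, hx₂, ex⟩ := S.exists_shiftOp_eq x
  obtain ⟨hy₁, hy₂, ey⟩ := S.exists_shiftOp_eq y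
  rw [hx', hy', ← hx, ← hy, ex, ey]
  -- Skew-symmetry is applied to the pairs $x,(\mathcal H+\sigma)y$ and $(\mathcal H+\sigma)x,y$,
  -- all of which lie in $D(\mathcal H)$.
  have h₁ := S.skewForm_op ⟨x, hx₁⟩ ⟨_, hy₂⟩
  have h₂ := S.skewForm_op ⟨_, hx₂⟩ ⟨y, hy₁⟩
  simp only [map_add, map_sub, map_smul, LinearMap.add_apply, LinearMap.sub_apply,
    LinearMap.smul_apply, smul_eq_mul] at h₁ h₂ ⊢
  linear_combination h₁ - h₂

/-! ### Simple eigenvalues -/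

theorem charMatrixDeriv_eq (z : ℂ) : S.charMatrixDeriv z = 1 -
    ∑ k ∈ Finset.Icc 1 K,
      ((-(S.τ k : ℂ) * Complex.exp (-z * (S.τ k : ℂ))) • S.Hc (-(k : ℤ)) +
        ((S.τ k : ℂ) * Complex.exp (z * (S.τ k : ℂ))) • S.Hc (k : ℤ)) := by
  ext i j
  simp only [charMatrixDeriv, charMatrix, Matrix.of_apply, Matrix.sub_apply, Matrix.smul_apply,
    Matrix.sum_apply, Matrix.add_apply, smul_eq_mul]
  refine HasDerivAt.deriv ?_
  have h₀ : HasDerivAt (fun s : ℂ => s * (1 : Matrix (Fin n ⊕ Fin n) (Fin n ⊕ Fin n) ℂ) i j -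
      S.Hc 0 i j) ((1 : Matrix (Fin n ⊕ Fin n) (Fin n ⊕ Fin n) ℂ) i j) z := by
    simpa using ((hasDerivAt_id z).mul_const
      ((1 : Matrix (Fin n ⊕ Fin n) (Fin n ⊕ Fin n) ℂ) i j)).sub_const (S.Hc 0 i j)
  refine h₀.sub (HasDerivAt.fun_sum fun k _ => ?_)
  have h₁ : HasDerivAt (fun s : ℂ => Complex.exp (-s * (S.τ k : ℂ)))
      (-(S.τ k : ℂ) * Complex.exp (-z * (S.τ k : ℂ))) z := by
    simpa [mul_comm] using (((hasDerivAt_id z).neg).mul_const (S.τ k : ℂ)).cexp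
  have h₂ : HasDerivAt (fun s : ℂ => Complex.exp (s * (S.τ k : ℂ)))
      ((S.τ k : ℂ) * Complex.exp (z * (S.τ k : ℂ))) z := by
    simpa [mul_comm] using ((hasDerivAt_id z).mul_const (S.τ k : ℂ)).cexp
  exact (h₁.mul_const _).add (h₂.mul_const _)

/-- The function `t ↦ exp (z t) (t v + u)`. -/
def jordanFun (z : ℂ) (v u : Fin n ⊕ Fin n → ℂ) : S.X :=
  S.restr (fun t => Complex.exp (z * (t : ℂ)) • ((t : ℂ) • v + u))
    (continuous_exp_smul z (by fun_prop))

theorem isDeriv_jordanFun (z : ℂ) (v u : Fin n ⊕ Fin n → ℂ) :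
    S.IsDeriv (S.jordanFun z v u) (z • S.jordanFun z v u + S.expFun z v) := by
  refine S.isDeriv_exp_smul z (by fun_prop) (f' := fun _ => v) (fun t => ?_) _ fun t ht => ?_
  · have h := (Complex.ofRealCLM.hasDerivAt (x := t)).smul_const v
    simpa using h.add_const u
  · rw [ev_add, ev_smul, S.ev_expFun z v ht, jordanFun, S.ev_restr _ ht]
    module

/-- Since $te^{zt}v=\partial_z(e^{zt}v)$, the first part is the $z$-derivative of $zv-M(z)v$; the
second is the value for $e^{zt}u$. -/
theorem boundaryMap_jordanFun (z : ℂ) (v u : Fin n ⊕ Fin n → ℂ) :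
    S.boundaryMap (S.jordanFun z v u) =
      v - S.charMatrixDeriv z *ᵥ v + (z • u - S.charMatrix z *ᵥ u) := by
  rw [← boundaryMap_expFun, jordanFun, expFun, boundaryMap_restr, boundaryMap_restr,
    charMatrixDeriv_eq, Matrix.sub_mulVec, Matrix.one_mulVec, sub_sub_cancel, Matrix.sum_mulVec]
  rw [add_left_comm, ← Finset.sum_add_distrib]
  simp only [Complex.ofReal_zero, zero_smul, zero_add]
  congr 1
  refine Finset.sum_congr rfl fun k _ => ?_
  simp only [Matrix.mulVec_smul, Matrix.mulVec_add, Matrix.add_mulVec, Matrix.smul_mulVec,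
    Complex.ofReal_neg, mul_neg, neg_mul]
  module

/-- For a simple eigenvalue, `wᵀ M'(λ) v ≠ 0`. -/
theorem dotProduct_charMatrixDeriv_ne_zero {lam : ℂ} (hs : S.op.IsSimpleEigenvalue lam)
    {v w : Fin n ⊕ Fin n → ℂ} (hv0 : v ≠ 0) (hv : S.charMatrix lam *ᵥ v = 0) (hw0 : w ≠ 0)
    (hw : w ᵥ* S.charMatrix lam = 0) : w ⬝ᵥ (S.charMatrixDeriv lam *ᵥ v) ≠ 0 := by
  intro h
  have hmem : ∀ c, S.charMatrix lam *ᵥ c = 0 → S.expFun lam c ∈ S.op.genKer lam 1 := fun c hc =>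
    S.op.mem_genKer_succ lam 0 ⟨_, S.expFun_mem_op_domain hc⟩ <| by
      rw [S.op_eq (S.isDeriv_expFun lam c), sub_self]
      exact Submodule.zero_mem _
  have hker : ∀ c, S.charMatrix lam *ᵥ c = 0 → ∃ a : ℂ, a • v = c := fun c hc => by
    obtain ⟨a, ha⟩ := LinearPMap.exists_smul_eq_of_isSimpleEigenvalue hs
      (S.expFun_ne_zero hv0) (hmem v hv) (hmem c hc)
    refine ⟨a, ?_⟩
    rw [← S.ev_expFun_zero lam c, ← ha, ev_smul, ev_expFun_zero]
  -- The equation $M(\lambda)u=-M'(\lambda)v$ is exactly the condition for $e^{\lambda t}(tv+u)$ to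
  -- lie in $D(\mathcal H)$.
  obtain ⟨u, hu⟩ := Matrix.exists_mulVec_eq_of_dotProduct_eq_zero hker hw0 hw
    (y := -(S.charMatrixDeriv lam *ᵥ v)) (by rw [dotProduct_neg, h, neg_zero])
  have hdom : S.jordanFun lam v u ∈ S.op.domain := by
    refine S.mem_op_domain (S.isDeriv_jordanFun lam v u) ?_
    rw [boundaryMap_jordanFun, hu, ev_add, ev_smul, ev_expFun_zero, jordanFun,
      S.ev_restr _ S.zero_mem_dom]
    simp only [Complex.ofReal_zero, mul_zero, Complex.exp_zero, zero_smul, zero_add, one_smul]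
    module
  have hop := S.op_eq (φ := ⟨_, hdom⟩) (S.isDeriv_jordanFun lam v u)
  have hj : S.jordanFun lam v u ∈ S.op.genKer lam 2 :=
    S.op.mem_genKer_succ lam 1 ⟨_, hdom⟩ <| by
      rw [hop, add_sub_cancel_left]
      exact hmem v hv
  obtain ⟨a, ha⟩ := LinearPMap.exists_smul_eq_of_isSimpleEigenvalue hs
    (S.expFun_ne_zero hv0) (hmem v hv) hj
  -- Were the chain vector a multiple of $e^{\lambda t}v$, comparing its two derivatives would force
  -- $e^{\lambda t}v=0$.
  have hd := S.isDeriv_jordanFun lam v u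
  rw [← ha] at hd
  have he := hd.unique ((S.isDeriv_expFun lam v).smul a)
  rw [smul_comm] at he
  exact S.expFun_ne_zero hv0 (left_eq_add.mp he.symm)

/-- The exponentials of $\pm z\theta$ cancel, so each integrand is constant and its integral
contributes the factor $\tau_k$ found in $M'(z)$. -/
theorem bilin_expFun (z : ℂ) (v w : Fin n ⊕ Fin n → ℂ) :
    S.bilin (S.expFun z v) (S.applyJ (S.expFun (-z) (hamJ n ℂ *ᵥ w))) =
      -(w ⬝ᵥ (S.charMatrixDeriv z *ᵥ v)) := by
  have hev : ∀ t ∈ S.dom, S.ev (S.applyJ (S.expFun (-z) (hamJ n ℂ *ᵥ w))) t =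
      -(Complex.exp (-z * (t : ℂ)) • w) := fun t ht => by
    rw [ev_applyJ, S.ev_expFun _ _ ht, Matrix.mulVec_smul, hamJ_mulVec_hamJ_mulVec, smul_neg]
  unfold bilin
  rw [ev_applyJ, ev_expFun_zero, ev_expFun_zero, hamJ_mulVec_hamJ_mulVec, neg_dotProduct,
    charMatrixDeriv_eq, Matrix.sub_mulVec, Matrix.one_mulVec, dotProduct_sub, Matrix.sum_mulVec,
    dotProduct_sum, neg_sub', sub_neg_eq_add]
  congr 1
  refine Finset.sum_congr rfl fun k hk => ?_
  have hk' : k ∈ Set.Icc 1 K := by simpa using hk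
  have hpos := S.τ_pos k hk'
  have hle := S.τ_le_last hk'
  have hmem : ∀ θ ∈ Set.uIcc 0 (S.τ k), θ ∈ S.dom ∧ θ - S.τ k ∈ S.dom := fun θ hθ => by
    rw [Set.uIcc_of_le hpos.le] at hθ
    exact ⟨⟨by linarith [hθ.1], by linarith [hθ.2]⟩, ⟨by linarith [hθ.1], by linarith [hθ.2]⟩⟩
  have h₁ : ∫ θ in (0 : ℝ)..S.τ k, S.ev (S.applyJ (S.expFun (-z) (hamJ n ℂ *ᵥ w))) θ ⬝ᵥ
      (S.Hc (-(k : ℤ)) *ᵥ S.ev (S.expFun z v) (θ - S.τ k)) =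
      ∫ θ in (0 : ℝ)..S.τ k,
        -(Complex.exp (-z * (S.τ k : ℂ)) * (w ⬝ᵥ (S.Hc (-(k : ℤ)) *ᵥ v))) := by
    refine intervalIntegral.integral_congr fun θ hθ => ?_
    obtain ⟨ht, ht'⟩ := hmem θ hθ
    have he : Complex.exp (-z * (S.τ k : ℂ)) =
        Complex.exp (z * ((θ - S.τ k : ℝ) : ℂ)) * Complex.exp (-z * (θ : ℂ)) := by
      rw [← Complex.exp_add]
      congr 1
      push_cast
      ring
    simp only [hev θ ht, S.ev_expFun _ _ ht', neg_dotProduct, smul_dotProduct,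
      Matrix.mulVec_smul, dotProduct_smul, smul_eq_mul, he]
    ring
  have h₂ : ∫ θ in (0 : ℝ)..S.τ k,
      S.ev (S.applyJ (S.expFun (-z) (hamJ n ℂ *ᵥ w))) (θ - S.τ k) ⬝ᵥ
      (S.Hc (k : ℤ) *ᵥ S.ev (S.expFun z v) θ) =
      ∫ θ in (0 : ℝ)..S.τ k,
        -(Complex.exp (z * (S.τ k : ℂ)) * (w ⬝ᵥ (S.Hc (k : ℤ) *ᵥ v))) := by
    refine intervalIntegral.integral_congr fun θ hθ => ?_
    obtain ⟨ht, ht'⟩ := hmem θ hθ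
    have he : Complex.exp (z * (S.τ k : ℂ)) =
        Complex.exp (z * (θ : ℂ)) * Complex.exp (-z * ((θ - S.τ k : ℝ) : ℂ)) := by
      rw [← Complex.exp_add]
      congr 1
      push_cast
      ring
    simp only [hev _ ht', S.ev_expFun _ _ ht, neg_dotProduct, smul_dotProduct,
      Matrix.mulVec_smul, dotProduct_smul, smul_eq_mul, he]
    ring
  rw [h₁, h₂, intervalIntegral.integral_const, intervalIntegral.integral_const]
  simp only [Matrix.add_mulVec, Matrix.smul_mulVec, dotProduct_add, dotProduct_smul, smul_eq_mul,
    Complex.real_smul, sub_zero]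
  ring

end HamDelaySystem

/-! ### The theorem -/

theorem mainTheorem2 {n K : ℕ} (S : HamDelaySystem n K) (σ : ℂ)
    (hσ : ¬ S.op.IsEigenvalue σ)
    (φ₁ : S.X) (hφ₁ : ∀ t i, (φ₁ t i).im = 0)
    (lam : ℂ) (hlam : lam ≠ 0) (hsimple : S.op.IsSimpleEigenvalue lam)
    (φp φm : S.X) (hp : S.op.IsEigenpair lam φp) (hm : S.op.IsEigenpair (-lam) φm)
    (m : ℕ) :
    Function.Bijective (S.shiftOp σ).toFun ∧
    Module.finrank ℂ
      ↥(Submodule.span ℂ {φp, φm} ⊓ krylovSubspace (S.shiftInv σ) φ₁ m) ≤ 1 ∧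
    ∃ v w : Fin n ⊕ Fin n → ℂ,
      v ≠ 0 ∧ w ≠ 0 ∧
      S.charMatrix lam *ᵥ v = 0 ∧ w ᵥ* S.charMatrix lam = 0 ∧
      (∀ t : S.dom, φp t = Complex.exp (lam * ((t : ℝ) : ℂ)) • v) ∧
      (∀ t : S.dom, φm t = Complex.exp (-lam * ((t : ℝ) : ℂ)) • (hamJ n ℂ *ᵥ w)) ∧
      S.bilin φp (S.applyJ φm) = -(w ⬝ᵥ (S.charMatrixDeriv lam *ᵥ v)) ∧
      S.bilin φp (S.applyJ φm) ≠ 0 := by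
  obtain ⟨v, hv0, hv, rfl⟩ := S.exists_eq_expFun_of_isEigenpair hp
  obtain ⟨u, hu0, hu, rfl⟩ := S.exists_eq_expFun_of_isEigenpair hm
  -- Since $J^{-1}=-J$, the coefficient of $\varphi_-$ can be written as $Jw$.
  obtain ⟨w, rfl⟩ : ∃ w, hamJ n ℂ *ᵥ w = u :=
    ⟨-(hamJ n ℂ *ᵥ u), by rw [Matrix.mulVec_neg, hamJ_mulVec_hamJ_mulVec, neg_neg]⟩
  have hw0 : w ≠ 0 := fun h => hu0 (by rw [h, Matrix.mulVec_zero])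
  have hw := S.vecMul_charMatrix_eq_zero hu
  have hne := S.dotProduct_charMatrixDeriv_ne_zero hsimple hv0 hv hw0 hw
  have hbilin := S.bilin_expFun lam v w
  have hne' := hbilin ▸ neg_ne_zero.mpr hne
  refine ⟨S.shiftOp_bijective hσ, finrank_span_pair_inf_le_one _ _ _ fun h₁ h₂ => hne' ?_,
    v, w, hv0, hw0, hv, hw, fun _ => rfl, fun _ => rfl, hbilin, hne'⟩
  exact krylovSubspace_isotropic S.skewForm S.skewForm_swap _ (S.skewForm_shiftInv hσ) φ₁ m h₁ h₂

end
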